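/- **Theorem (Global FDR control: non-quantized model exchange).** Consider $K\ge 2$ agents. For each agent $a$ fix integers $k_a,\ell_a,m_a\ge 0$. Agent $a$ splits its data into $K$ disjoint blocks $Z^{(a\to 1)},\dots,Z^{(a\to K)}$. Each block $Z^{(a\to b)}$ consists of $k_a$ labelled null training samples, $\ell_a$ null calibration samples and $m_a$ unlabelled test samples, all random elements of a measurable space $\mathcal Z$; the training and calibration samples of agent $a$ have law $P_0^{(a)}$. The block $Z^{(j\to j)}$ is the evaluation block of agent $j$, with calibration samples $Y^{(j)}_1,\dots,Y^{(j)}_{\ell_j}$ and test samples $X^{(j)}_1,\dots,X^{(j)}_{m_j}$. Let $\mathcal H_0^{(j)}\subseteq\{1,\dots,m_j\}$ be its set of true nulls: $t\in\mathcal H_0^{(j)}$ if $X^{(j)}_t\sim P_0^{(j)}$, and $t\notin\mathcal H_0^{(j)}$ if the law of $X^{(j)}_t$ differs from $P_0^{(a)}$ for all $a$; the test samples with $t\notin\mathcal H_0^{(j)}$ are the novelties. Put $\mathcal H_0=\{(j,t): t\in\mathcal H_0^{(j)}\}$. Assume: 1. the data of different agents are mutually independent, and for each agent its $K$ blocks are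 mutually independent; 2. for each $j$, the family of all nulls of the evaluation block $Z^{(j\to j)}$ (its training and calibration samples and the $X^{(j)}_t$, $t\in\mathcal H_0^{(j)}$) is exchangeable conditionally on the novelties $(X^{(j)}_t)_{t\notin\mathcal H_0^{(j)}}$ of that block; 3. each agent $a$ has a deterministic measurable score function $g^{(a)}(z;H)\in\mathbb R$ of a point $z\in\mathcal Z$ and a block $H$, and its value does not change when the calibration and test samples in $H$ are permuted among themselves while the training samples are kept fixed; 4. for each $j$, almost surely there are no ties among the composite scores of the calibration and test samples of the evaluation block of agent $j$, where the composite score is $$S^{(j)}(z)=\max_{1\le a\le K} g^{(a)}\bigl(z;Z^{(a\to j)}\bigr).$$ Define the empirical conformal $p$-values $$p^{(j)}_t=\frac{1}{\ell_j+1}\Bigl(1+\sum_{i=1}^{\ell_j}\mathbf 1\bigl\{S^{(j)}(Y^{(j)}_i)\ge S^{(j)}(X^{(j)}_t)\bigr\}\Bigr),\qquad 1\le t\le m_j .$$ Then the concatenated vector $\mathbf P=(p^{(j)}_t)_{1\le j\le K,\,1\le t\le m_j}$ is positively regression dependent on the subset $\mathcal H_0$ (PRDS): for every increasing set $D$ and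 every $i\in\mathcal H_0$, $\mathbb P(\mathbf P\in D\mid P_i=x)$ is a non-decreasing function of $x$. Moreover, let $\alpha\in(0,1)$ and $M=\sum_j m_j$. The FastLSU procedure at level $\alpha$ starts from $r=M$ and repeatedly replaces $r$ by $\sum_j\#\{t:p^{(j)}_t\le \alpha r/M\}$ until $r$ no longer changes; agent $j$ then rejects all $t$ with $p^{(j)}_t\le\alpha r/M$. Let $R^{(j)}$ and $V^{(j)}$ be the number of rejections and of rejected true nulls of agent $j$. Then $$\mathrm{FDR}_{\mathrm{global}}=\mathbb E\left[\frac{\sum_{j}V^{(j)}}{\bigl(\sum_{j}R^{(j)}\bigr)\vee 1}\right]\le\alpha .$$ -/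

import Mathlib

open MeasureTheory ProbabilityTheory
open scoped Classical

noncomputable section

namespace ModelExchange

/-- Positions in one data block: `k` null samples used as labelled training data, then `ℓ` null
samples used for calibration, then `m` test samples. -/
abbrev BlockIdx (k ℓ m : ℕ) : Type := Fin k ⊕ (Fin ℓ ⊕ Fin m)

/-- Position of the `t`-th test sample of a block. -/
abbrev testIdx {k ℓ m : ℕ} (t : Fin m) : BlockIdx k ℓ m := Sum.inr (Sum.inr t)

/-- Position of the `i`-th calibration sample of a block. -/
abbrev calIdx {k ℓ m : ℕ} (i : Fin ℓ) : BlockIdx k ℓ m := Sum.inr (Sum.inl i)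

/-- Position of the `i`-th labelled training sample of a block. -/
abbrev trainIdx {k ℓ m : ℕ} (i : Fin k) : BlockIdx k ℓ m := Sum.inl i

/-- Positions of the nulls of a block whose set of true null test samples is `H0`: all training and
calibration positions, and the test positions in `H0`. -/
def nullPositions {k ℓ m : ℕ} (H0 : Set (Fin m)) : Set (BlockIdx k ℓ m) :=
  {x | ∀ t : Fin m, x = testIdx t → t ∈ H0}

/-- The family `U` is exchangeable conditionally on the family `V`: for every permutation `π` of the
index set of `U`, the conditional laws of `U` and of `U ∘ π` given `σ(V)` agree. -/
def CondExchangeable {Ω E ι κ : Type*} [MeasurableSpace Ω] [MeasurableSpace E] (μ : Measure Ω)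
    (U : ι → Ω → E) (V : κ → Ω → E) : Prop :=
  ∀ π : Equiv.Perm ι, ∀ A : Set (ι → E), MeasurableSet A →
    μ⟦(fun ω i => U (π i) ω) ⁻¹' A | MeasurableSpace.comap (fun ω i => V i ω) inferInstance⟧
      =ᵐ[μ] μ⟦(fun ω i => U i ω) ⁻¹' A | MeasurableSpace.comap (fun ω i => V i ω) inferInstance⟧

/-- Positive regression dependence on the subset `I₀`. `X` is a random vector such that, for every
increasing set `D` for which `X ∈ D` is an event and every `i ∈ I₀`, the conditional probability
`ℙ(X ∈ D | X i = x)` (that is, a version of it) is a non-decreasing function of `x`. -/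
def IsPRDS {Ω ι : Type*} [MeasurableSpace Ω] (μ : Measure Ω) (X : ι → Ω → ℝ) (I₀ : Set ι) : Prop :=
  (∀ i, Measurable (X i)) ∧
  ∀ D : Set (ι → ℝ), IsUpperSet D → MeasurableSet ((fun ω i => X i ω) ⁻¹' D) → ∀ i ∈ I₀,
    ∃ f : ℝ → ℝ, Monotone f ∧
      μ⟦(fun ω i => X i ω) ⁻¹' D | MeasurableSpace.comap (X i) inferInstance⟧
        =ᵐ[μ] fun ω => f (X i ω)

section Scores

variable {K : ℕ} {k ℓ m : Fin K → ℕ} {E : Type*}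

/-- The composite score of agent `j`: the maximum over all agents `a` of the score of `z` under the
model `g a` trained on the block `H a` that agent `a` designated for agent `j`. -/
def compositeScore (g : (a : Fin K) → E → (BlockIdx (k a) (ℓ a) (m a) → E) → ℝ) (j : Fin K)
    (H : (a : Fin K) → BlockIdx (k a) (ℓ a) (m a) → E) (z : E) : ℝ :=
  Finset.univ.sup' ⟨j, Finset.mem_univ j⟩ fun a => g a z (H a)

/-- The empirical conformal p-value of the `t`-th test sample of agent `j`. It is computed on the
evaluation block `H j` with the composite score. -/
def pValue (g : (a : Fin K) → E → (BlockIdx (k a) (ℓ a) (m a) → E) → ℝ) (j : Fin K)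
    (H : (a : Fin K) → BlockIdx (k a) (ℓ a) (m a) → E) (t : Fin (m j)) : ℝ :=
  (1 / ((ℓ j : ℝ) + 1)) *
    (1 + ∑ i : Fin (ℓ j),
      if compositeScore g j H (H j (testIdx t)) ≤ compositeScore g j H (H j (calIdx i))
      then (1 : ℝ) else 0)

end Scores

section FastLSU

variable {K : ℕ} {m : Fin K → ℕ}

/-- Number of tests in the whole network. -/
def totalTests (m : Fin K → ℕ) : ℕ := ∑ j, m j

/-- Number of p-values of one agent that do not exceed the threshold `τ`. -/
def localCount {n : ℕ} (p : Fin n → ℝ) (τ : ℝ) : ℕ :=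
  (Finset.univ.filter fun t => p t ≤ τ).card

/-- One round of FastLSU: the current global count `r` is broadcast, every agent returns the number
of its p-values at most `α r / M` (`M` tests in total), and these numbers are added. -/
def fastLSUStep (p : (j : Fin K) → Fin (m j) → ℝ) (α : ℝ) (r : ℕ) : ℕ :=
  ∑ j, localCount (p j) (α * r / totalTests m)

/-- The final global count of FastLSU: start from `M` and repeat rounds until the count no longer
changes. This has happened after at most `M` rounds, see `fastLSUCount_stable`. -/
def fastLSUCount (p : (j : Fin K) → Fin (m j) → ℝ) (α : ℝ) : ℕ :=
  (fastLSUStep p α)^[totalTests m] (totalTests m)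

theorem localCount_mono {n : ℕ} (p : Fin n → ℝ) {τ τ' : ℝ} (h : τ ≤ τ') :
    localCount p τ ≤ localCount p τ' := by
  unfold localCount
  refine Finset.card_le_card fun t ht => ?_
  simp only [Finset.mem_filter, Finset.mem_univ, true_and] at ht ⊢
  exact ht.trans h

theorem fastLSUStep_mono (p : (j : Fin K) → Fin (m j) → ℝ) {α : ℝ} (hα : 0 ≤ α) :
    Monotone (fastLSUStep p α) := by
  intro r s h
  unfold fastLSUStep
  refine Finset.sum_le_sum fun j _ => localCount_mono _ ?_
  have : (r : ℝ) ≤ s := by exact_mod_cast h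
  gcongr

theorem fastLSUStep_le (p : (j : Fin K) → Fin (m j) → ℝ) (α : ℝ) (r : ℕ) :
    fastLSUStep p α r ≤ totalTests m := by
  unfold fastLSUStep totalTests localCount
  refine Finset.sum_le_sum fun j _ => ?_
  exact (Finset.card_le_univ _).trans (by simp)

/-- The count of FastLSU is stationary after `M` rounds. -/
theorem fastLSUCount_stable (p : (j : Fin K) → Fin (m j) → ℝ) {α : ℝ} (hα : 0 ≤ α) :
    fastLSUStep p α (fastLSUCount p α) = fastLSUCount p α := by
  set f := fastLSUStep p α with hf
  set M := totalTests m with hM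
  have hanti : ∀ i, f (f^[i] M) ≤ f^[i] M := by
    intro i
    induction i with
    | zero => exact fastLSUStep_le p α _
    | succ i ih =>
      rw [Function.iterate_succ_apply']
      exact fastLSUStep_mono p hα ih
  have key : ∀ i, f (f^[i] M) = f^[i] M ∨ f^[i] M + i ≤ M := by
    intro i
    induction i with
    | zero => right; simp
    | succ i ih =>
      rw [Function.iterate_succ_apply']
      rcases ih with h | h
      · left; rw [h, h]
      · rcases (hanti i).eq_or_lt with h' | h'
        · left; rw [h', h']
        · right; omega
  have hc : fastLSUCount p α = f^[M] M := rfl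
  rw [hc]
  rcases key M with h | h
  · exact h
  · have := hanti M
    omega

/-- The set of tests that agent `j` rejects under FastLSU at level `α`. -/
def fastLSURejections (p : (j : Fin K) → Fin (m j) → ℝ) (α : ℝ) (j : Fin K) : Finset (Fin (m j)) :=
  Finset.univ.filter fun t => p j t ≤ α * fastLSUCount p α / totalTests m

/-- The global false discovery proportion `(∑ V_j) / ((∑ R_j) ∨ 1)` of rejection sets `R j`, where
`H0 j` is the set of true nulls among the tests of agent `j`. -/
def globalFDP (H0 : (j : Fin K) → Set (Fin (m j))) (R : (j : Fin K) → Finset (Fin (m j))) : ℝ :=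
  (∑ j, (((R j).filter fun t => t ∈ H0 j).card : ℝ)) / max (∑ j, ((R j).card : ℝ)) 1

end FastLSU

end ModelExchange

end

/-! Fix a true null `t` of agent `j` and let `N` be the number of calibration scores at least its
own, so that its p-value is `(1 + N) / (ℓ j + 1)`. Exchanging `t` with a calibration sample `c` of
the evaluation block preserves the law of all the data: conditional exchangeability gives this for
the block, and independence extends it to the network (`map_block_swap`,
`measurePreserving_swapData`). Since the score functions ignore the order of calibration and test
samples, the exchange of data merely exchanges two scores (`scoreFamily_swapData`), so the law of
the scores is invariant too.

On `N = r < ℓ j`, let `c` carry the calibration score just below that of `t`. The exchange leads to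
`N = r + 1` with `c` just above `t`, and it lowers no p-value. Hence, for increasing `D`, the
probability of `N = r` and `P ∈ D` is at most that of `N = r + 1` and `P ∈ D`
(`measure_exceedCount_inter_upperSet_le`). Without `D` the two are equal, so `N` is uniform
(`measureReal_exceedCount`). Dividing gives conditional probabilities that grow with `r`, which is
PRDS.

The FastLSU count `R` decreases in the p-values, so `R ≤ k` is an increasing event, and the
telescoping argument of Benjamini and Yekutieli (`sum_rejection_prob_le`) bounds the contribution of
each true null to the FDR by `α / M`. -/

namespace ModelExchange

/-! ### Deterministic effect of one exchange on ranks and p-values. -/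

section Ranks

variable {ℓ m : ℕ}

/-- Number of calibration scores that are at least `v`. -/
noncomputable def exceedCount (s : Fin ℓ ⊕ Fin m → ℝ) (v : ℝ) : ℕ :=
  (Finset.univ.filter fun c : Fin ℓ => v ≤ s (Sum.inl c)).card

theorem exceedCount_le (s : Fin ℓ ⊕ Fin m → ℝ) (v : ℝ) : exceedCount s v ≤ ℓ :=
  (Finset.card_le_univ _).trans (by simp)

theorem exceedCount_antitone (s : Fin ℓ ⊕ Fin m → ℝ) : Antitone (exceedCount s) := by
  intro v w h
  refine Finset.card_le_card fun c hc => ?_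
  simp only [Finset.mem_filter, Finset.mem_univ, true_and] at hc ⊢
  exact h.trans hc

theorem exceedCount_lt_of_lt (s : Fin ℓ ⊕ Fin m → ℝ) {c : Fin ℓ} {v : ℝ}
    (h : s (Sum.inl c) < v) : exceedCount s v < exceedCount s (s (Sum.inl c)) := by
  refine Finset.card_lt_card ((Finset.ssubset_iff_of_subset fun d hd => ?_).2 ⟨c, ?_, ?_⟩)
  · simp only [Finset.mem_filter, Finset.mem_univ, true_and] at hd ⊢
    exact h.le.trans hd
  · simp
  · simpa using h

/-- Only the summand of `c` changes. The additive form avoids truncated subtraction. -/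
theorem exceedCount_swap (s : Fin ℓ ⊕ Fin m → ℝ) (t : Fin m) (c : Fin ℓ) (v : ℝ) :
    exceedCount (s ∘ Equiv.swap (Sum.inr t) (Sum.inl c)) v + (if v ≤ s (Sum.inl c) then 1 else 0)
      = exceedCount s v + (if v ≤ s (Sum.inr t) then 1 else 0) := by
  unfold exceedCount
  rw [Finset.card_filter, Finset.card_filter, ← Finset.add_sum_erase _ _ (Finset.mem_univ c),
    ← Finset.add_sum_erase _ (fun d => if v ≤ s (Sum.inl d) then 1 else 0) (Finset.mem_univ c)]
  have : ∑ d ∈ Finset.univ.erase c,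
      (if v ≤ (s ∘ Equiv.swap (Sum.inr t) (Sum.inl c)) (Sum.inl d) then 1 else 0)
      = ∑ d ∈ Finset.univ.erase c, (if v ≤ s (Sum.inl d) then 1 else 0) := by
    refine Finset.sum_congr rfl fun d hd => ?_
    rw [Function.comp_apply, Equiv.swap_apply_of_ne_of_ne (by simp)]
    simpa using Finset.ne_of_mem_erase hd
  rw [this, Function.comp_apply, Equiv.swap_apply_right]
  ring

/-- Calibration position `c` carries the largest calibration score below the score of test
position `t`, and exactly `r` calibration scores are at least the latter. -/
def IsNextBelow (s : Fin ℓ ⊕ Fin m → ℝ) (t : Fin m) (r : ℕ) (c : Fin ℓ) : Prop :=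
  s (Sum.inl c) < s (Sum.inr t) ∧ exceedCount s (s (Sum.inr t)) = r ∧
    exceedCount s (s (Sum.inl c)) = r + 1

/-- Calibration position `c` carries the smallest calibration score above the score of test
position `t`, and exactly `r + 1` calibration scores are at least the latter. -/
def IsNextAbove (s : Fin ℓ ⊕ Fin m → ℝ) (t : Fin m) (r : ℕ) (c : Fin ℓ) : Prop :=
  s (Sum.inr t) < s (Sum.inl c) ∧ exceedCount s (s (Sum.inr t)) = r + 1 ∧
    exceedCount s (s (Sum.inl c)) = r + 1

/-- At the lower of the two scores the count keeps its value `r + 1`; at the higher one it gains the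
new occupant of `c` and rises from `r` to `r + 1`. -/
theorem isNextAbove_swap (s : Fin ℓ ⊕ Fin m → ℝ) (t : Fin m) (r : ℕ) (c : Fin ℓ) :
    IsNextAbove (s ∘ Equiv.swap (Sum.inr t) (Sum.inl c)) t r c ↔ IsNextBelow s t r c := by
  unfold IsNextAbove IsNextBelow
  have h1 := exceedCount_swap s t c (s (Sum.inl c))
  have h2 := exceedCount_swap s t c (s (Sum.inr t))
  simp only [Function.comp_apply, Equiv.swap_apply_left, Equiv.swap_apply_right] at *
  refine and_congr_right fun h => ?_
  simp only [le_refl, if_true, h.le, not_le.2 h, if_false] at h1 h2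
  omega

theorem exceedCount_cal_injective {s : Fin ℓ ⊕ Fin m → ℝ} (hs : Function.Injective s)
    {c d : Fin ℓ} (h : exceedCount s (s (Sum.inl c)) = exceedCount s (s (Sum.inl d))) : c = d := by
  by_contra hne
  have : s (Sum.inl c) ≠ s (Sum.inl d) := fun e => hne (Sum.inl_injective (hs e))
  rcases lt_or_gt_of_ne this with h' | h'
  · exact (exceedCount_lt_of_lt s h').ne' h
  · exact (exceedCount_lt_of_lt s h').ne h

theorem exists_isNextBelow {s : Fin ℓ ⊕ Fin m → ℝ} (hs : Function.Injective s) {t : Fin m} {r : ℕ}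
    (hr : r < ℓ) (h : exceedCount s (s (Sum.inr t)) = r) : ∃ c, IsNextBelow s t r c := by
  have hne : (Finset.univ.filter fun c : Fin ℓ => s (Sum.inl c) < s (Sum.inr t)).Nonempty := by
    by_contra hcon
    rw [Finset.not_nonempty_iff_eq_empty, Finset.filter_eq_empty_iff] at hcon
    have : exceedCount s (s (Sum.inr t)) = ℓ := by
      unfold exceedCount
      rw [Finset.filter_true_of_mem fun c hc => not_lt.1 (hcon hc)]
      simp
    omega
  obtain ⟨c, hc, hmax⟩ := Finset.exists_max_image _ (fun c => s (Sum.inl c)) hne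
  simp only [Finset.mem_filter, Finset.mem_univ, true_and] at hc hmax
  refine ⟨c, hc, h, le_antisymm ?_ (h ▸ exceedCount_lt_of_lt s hc)⟩
  rw [← h]
  unfold exceedCount
  -- A calibration score at least that of the maximiser `c` is `c` itself or already exceeds the
  -- test score.
  rw [← Finset.card_insert_of_notMem (a := c) (by simpa using hc)]
  refine Finset.card_le_card fun d hd => ?_
  simp only [Finset.mem_insert, Finset.mem_filter, Finset.mem_univ, true_and] at hd ⊢
  by_contra hcon
  push Not at hcon
  exact hcon.1 (Sum.inl_injective (hs ((hmax d hcon.2).antisymm hd)))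

theorem exists_isNextAbove {s : Fin ℓ ⊕ Fin m → ℝ} (hs : Function.Injective s) {t : Fin m} {r : ℕ}
    (h : exceedCount s (s (Sum.inr t)) = r + 1) : ∃ c, IsNextAbove s t r c := by
  have hne : (Finset.univ.filter fun c : Fin ℓ => s (Sum.inr t) ≤ s (Sum.inl c)).Nonempty := by
    exact Finset.card_pos.1 ((Nat.succ_pos r).trans_eq h.symm)
  obtain ⟨c, hc, hmin⟩ := Finset.exists_min_image _ (fun c => s (Sum.inl c)) hne
  simp only [Finset.mem_filter, Finset.mem_univ, true_and] at hc hmin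
  refine ⟨c, lt_of_le_of_ne hc fun e => by simpa using hs e, h, ?_⟩
  rw [← h]
  refine le_antisymm (exceedCount_antitone s hc) (Finset.card_le_card fun d hd => ?_)
  simp only [Finset.mem_filter, Finset.mem_univ, true_and] at hd ⊢
  exact hmin d hd

/-- The conformal p-value of test position `t` as a function of the vector of scores. -/
noncomputable def conformalPValue (s : Fin ℓ ⊕ Fin m → ℝ) (t : Fin m) : ℝ :=
  (1 + exceedCount s (s (Sum.inr t))) / (ℓ + 1)

/-- For `t` itself the threshold drops to a value that both exchanged scores attain, so the count
cannot fall. For any other test position the threshold is fixed and calibration slot `c` receives a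
score at least as large. -/
theorem conformalPValue_le_swap {s : Fin ℓ ⊕ Fin m → ℝ} {t : Fin m} {c : Fin ℓ}
    (h : s (Sum.inl c) ≤ s (Sum.inr t)) (u : Fin m) :
    conformalPValue s u ≤ conformalPValue (s ∘ Equiv.swap (Sum.inr t) (Sum.inl c)) u := by
  unfold conformalPValue
  gcongr
  by_cases hu : u = t
  · subst hu
    have h1 := exceedCount_swap s u c (s (Sum.inl c))
    simp only [Function.comp_apply, Equiv.swap_apply_left]
    simp only [le_refl, h, if_true, add_left_inj] at h1
    exact h1 ▸ exceedCount_antitone s h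
  · rw [Function.comp_apply, Equiv.swap_apply_of_ne_of_ne (by simpa using hu) (by simp)]
    have h1 := exceedCount_swap s t c (s (Sum.inr u))
    by_cases h2 : s (Sum.inr u) ≤ s (Sum.inl c)
    · simp only [h2, h2.trans h, if_true] at h1
      omega
    · simp only [h2, if_false] at h1
      omega

theorem measurable_exceedCount (t : Fin m) :
    Measurable fun s : Fin ℓ ⊕ Fin m → ℝ => exceedCount s (s (Sum.inr t)) := by
  unfold exceedCount
  simp only [Finset.card_filter]
  refine Finset.measurable_sum _ fun c _ => Measurable.ite ?_ measurable_const measurable_const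
  exact measurableSet_le (measurable_pi_apply _) (measurable_pi_apply _)

theorem measurable_exceedCount_cal (c : Fin ℓ) :
    Measurable fun s : Fin ℓ ⊕ Fin m → ℝ => exceedCount s (s (Sum.inl c)) := by
  unfold exceedCount
  simp only [Finset.card_filter]
  refine Finset.measurable_sum _ fun d _ => Measurable.ite ?_ measurable_const measurable_const
  exact measurableSet_le (measurable_pi_apply _) (measurable_pi_apply _)

theorem measurableSet_isNextBelow (t : Fin m) (r : ℕ) (c : Fin ℓ) :
    MeasurableSet {s : Fin ℓ ⊕ Fin m → ℝ | IsNextBelow s t r c} :=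
  (measurableSet_lt (measurable_pi_apply (Sum.inl c)) (measurable_pi_apply (Sum.inr t))).inter
    ((measurable_exceedCount t (measurableSet_singleton r)).inter
      (measurable_exceedCount_cal c (measurableSet_singleton (r + 1))))

theorem measurableSet_isNextAbove (t : Fin m) (r : ℕ) (c : Fin ℓ) :
    MeasurableSet {s : Fin ℓ ⊕ Fin m → ℝ | IsNextAbove s t r c} :=
  (measurableSet_lt (measurable_pi_apply (Sum.inr t)) (measurable_pi_apply (Sum.inl c))).inter
    ((measurable_exceedCount t (measurableSet_singleton (r + 1))).inter
      (measurable_exceedCount_cal c (measurableSet_singleton (r + 1))))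

end Ranks

/-! ### Laws of scores that are invariant under an exchange. -/

section ScoreLaw

variable {K : ℕ} {ℓ m : Fin K → ℕ}

/-- The family of all conformal p-values as a function of the scores of all agents. -/
noncomputable def pValueFamily (s : (j : Fin K) → Fin (ℓ j) ⊕ Fin (m j) → ℝ)
    (x : (j : Fin K) × Fin (m j)) : ℝ :=
  conformalPValue (s x.1) x.2

/-- Exchange of the scores of test position `t` and calibration position `c` of agent `j`. -/
def swapScores (j : Fin K) (t : Fin (m j)) (c : Fin (ℓ j))
    (s : (j : Fin K) → Fin (ℓ j) ⊕ Fin (m j) → ℝ) : (j : Fin K) → Fin (ℓ j) ⊕ Fin (m j) → ℝ :=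
  Function.update s j (s j ∘ Equiv.swap (Sum.inr t) (Sum.inl c))

theorem pValueFamily_le_swapScores {s : (j : Fin K) → Fin (ℓ j) ⊕ Fin (m j) → ℝ} {j : Fin K}
    {t : Fin (m j)} {c : Fin (ℓ j)} (h : s j (Sum.inl c) ≤ s j (Sum.inr t)) :
    pValueFamily s ≤ pValueFamily (swapScores j t c s) := by
  rintro ⟨i, u⟩
  unfold pValueFamily swapScores
  by_cases hi : i = j
  · subst hi
    simpa using conformalPValue_le_swap h u
  · simp [Function.update_of_ne hi]

/-- No measurability of `D` is needed: the p-values factor through finitely many integer counts,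
which form a countable discrete space. -/
theorem measurableSet_pValueFamily_preimage (D : Set ((j : Fin K) × Fin (m j) → ℝ)) :
    MeasurableSet (pValueFamily (ℓ := ℓ) ⁻¹' D) := by
  let N : ((j : Fin K) → Fin (ℓ j) ⊕ Fin (m j) → ℝ) → (j : Fin K) × Fin (m j) → ℕ :=
    fun s x => exceedCount (s x.1) (s x.1 (Sum.inr x.2))
  have hN : Measurable N := measurable_pi_lambda _ fun x =>
    (measurable_exceedCount x.2).comp (measurable_pi_apply x.1)
  exact hN ((Set.to_countable {n | (fun x => (1 + (n x : ℝ)) / (ℓ x.1 + 1)) ∈ D}).measurableSet)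

variable {ν : Measure ((j : Fin K) → Fin (ℓ j) ⊕ Fin (m j) → ℝ)} {j : Fin K} {t : Fin (m j)}

/-- Without ties the next lower calibration position exists, because `r < ℓ j`, and is unique. The
events are disjoint only up to a null set. -/
theorem measure_exceedCount_eq_sum_isNextBelow (hinj : ∀ᵐ s ∂ν, Function.Injective (s j))
    {D : Set ((j : Fin K) → Fin (ℓ j) ⊕ Fin (m j) → ℝ)} (hD : MeasurableSet D) {r : ℕ}
    (hr : r < ℓ j) :
    ν ({s | exceedCount (s j) (s j (Sum.inr t)) = r} ∩ D) =
      ∑ c, ν ({s | IsNextBelow (s j) t r c} ∩ D) := by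
  have hG : (⋃ c, {s : (j : Fin K) → Fin (ℓ j) ⊕ Fin (m j) → ℝ | IsNextBelow (s j) t r c} ∩ D)
      =ᵐ[ν] ({s | exceedCount (s j) (s j (Sum.inr t)) = r} ∩ D :
        Set ((j : Fin K) → Fin (ℓ j) ⊕ Fin (m j) → ℝ)) := by
    rw [Filter.eventuallyEq_set]
    filter_upwards [hinj] with s hs
    simp only [Set.mem_iUnion, Set.mem_inter_iff, Set.mem_ofPred_eq, exists_and_right]
    refine and_congr_left fun _ => ⟨fun ⟨c, hc⟩ => hc.2.1, exists_isNextBelow hs hr⟩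
  rw [← measure_congr hG, measure_iUnion₀, tsum_fintype]
  · intro c d hcd
    refine measure_mono_null ?_ (ae_iff.1 hinj)
    rintro s ⟨⟨hc, -⟩, hd, -⟩ hs
    exact hcd (exceedCount_cal_injective hs (hc.2.2.trans hd.2.2.symm))
  · exact fun c => ((measurableSet_isNextBelow t r c).preimage
      (measurable_pi_apply j)).nullMeasurableSet.inter hD.nullMeasurableSet

theorem measure_exceedCount_eq_sum_isNextAbove (hinj : ∀ᵐ s ∂ν, Function.Injective (s j))
    {D : Set ((j : Fin K) → Fin (ℓ j) ⊕ Fin (m j) → ℝ)} (hD : MeasurableSet D) (r : ℕ) :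
    ν ({s | exceedCount (s j) (s j (Sum.inr t)) = r + 1} ∩ D) =
      ∑ c, ν ({s | IsNextAbove (s j) t r c} ∩ D) := by
  have hG : (⋃ c, {s : (j : Fin K) → Fin (ℓ j) ⊕ Fin (m j) → ℝ | IsNextAbove (s j) t r c} ∩ D)
      =ᵐ[ν] ({s | exceedCount (s j) (s j (Sum.inr t)) = r + 1} ∩ D :
        Set ((j : Fin K) → Fin (ℓ j) ⊕ Fin (m j) → ℝ)) := by
    rw [Filter.eventuallyEq_set]
    filter_upwards [hinj] with s hs
    simp only [Set.mem_iUnion, Set.mem_inter_iff, Set.mem_ofPred_eq, exists_and_right]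
    refine and_congr_left fun _ => ⟨fun ⟨c, hc⟩ => hc.2.1, exists_isNextAbove hs⟩
  rw [← measure_congr hG, measure_iUnion₀, tsum_fintype]
  · intro c d hcd
    refine measure_mono_null ?_ (ae_iff.1 hinj)
    rintro s ⟨⟨hc, -⟩, hd, -⟩ hs
    exact hcd (exceedCount_cal_injective hs (hc.2.2.trans hd.2.2.symm))
  · exact fun c => ((measurableSet_isNextAbove t r c).preimage
      (measurable_pi_apply j)).nullMeasurableSet.inter hD.nullMeasurableSet

theorem swapScores_preimage_isNextAbove (r : ℕ) (c : Fin (ℓ j)) :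
    swapScores j t c ⁻¹' {s | IsNextAbove (s j) t r c} = {s | IsNextBelow (s j) t r c} := by
  ext s
  simp [swapScores, isNextAbove_swap]

theorem measure_exceedCount_inter_upperSet_le (hinj : ∀ᵐ s ∂ν, Function.Injective (s j))
    (hswap : ∀ c, MeasurePreserving (swapScores j t c) ν ν)
    {D : Set ((j : Fin K) × Fin (m j) → ℝ)} (hD : IsUpperSet D) {r : ℕ} (hr : r < ℓ j) :
    ν ({s | exceedCount (s j) (s j (Sum.inr t)) = r} ∩ pValueFamily ⁻¹' D) ≤
      ν ({s | exceedCount (s j) (s j (Sum.inr t)) = r + 1} ∩ pValueFamily ⁻¹' D) := by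
  have hDm := measurableSet_pValueFamily_preimage (ℓ := ℓ) D
  rw [measure_exceedCount_eq_sum_isNextBelow hinj hDm hr,
    measure_exceedCount_eq_sum_isNextAbove hinj hDm r]
  refine Finset.sum_le_sum fun c _ => ?_
  have h := (hswap c).measure_preimage (((measurableSet_isNextAbove t r c).preimage
    (measurable_pi_apply j)).inter hDm).nullMeasurableSet
  refine (measure_mono ?_).trans_eq h
  rintro s ⟨h1, h2⟩
  exact ⟨(swapScores_preimage_isNextAbove (t := t) r c).ge h1,
    hD (pValueFamily_le_swapScores h1.1.le) h2⟩

/-- With no increasing set to respect, the exchange matches the two events exactly, piece by piece.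
-/
theorem measure_exceedCount_succ (hinj : ∀ᵐ s ∂ν, Function.Injective (s j))
    (hswap : ∀ c, MeasurePreserving (swapScores j t c) ν ν) {r : ℕ} (hr : r < ℓ j) :
    ν {s | exceedCount (s j) (s j (Sum.inr t)) = r} =
      ν {s | exceedCount (s j) (s j (Sum.inr t)) = r + 1} := by
  have h1 := measure_exceedCount_eq_sum_isNextBelow (t := t) hinj MeasurableSet.univ hr
  have h2 := measure_exceedCount_eq_sum_isNextAbove (t := t) hinj MeasurableSet.univ r
  simp only [Set.inter_univ] at h1 h2
  rw [h1, h2]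
  refine Finset.sum_congr rfl fun c _ => ?_
  exact (congrArg ν (swapScores_preimage_isNextAbove r c).symm).trans
    ((hswap c).measure_preimage ((measurableSet_isNextAbove t r c).preimage
      (measurable_pi_apply j)).nullMeasurableSet)

theorem measureReal_exceedCount [IsProbabilityMeasure ν]
    (hinj : ∀ᵐ s ∂ν, Function.Injective (s j))
    (hswap : ∀ c, MeasurePreserving (swapScores j t c) ν ν) {r : ℕ} (hr : r ≤ ℓ j) :
    ν.real {s | exceedCount (s j) (s j (Sum.inr t)) = r} = 1 / ((ℓ j : ℝ) + 1) := by
  have hconst : ∀ r ≤ ℓ j, ν.real {s | exceedCount (s j) (s j (Sum.inr t)) = r} =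
      ν.real {s | exceedCount (s j) (s j (Sum.inr t)) = 0} := by
    intro r
    induction r with
    | zero => simp
    | succ r ih =>
      intro h
      rw [← ih (by omega), measureReal_def, measureReal_def, measure_exceedCount_succ hinj hswap h]
  have hsum : ∑ r ∈ Finset.range (ℓ j + 1),
      ν.real {s | exceedCount (s j) (s j (Sum.inr t)) = r} = 1 := by
    have := sum_measureReal_preimage_singleton (μ := ν) (Finset.range (ℓ j + 1))
      (f := fun s => exceedCount (s j) (s j (Sum.inr t)))
      (fun r _ => ((measurable_exceedCount t).comp (measurable_pi_apply j))
        (measurableSet_singleton r))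
    refine this.trans ?_
    rw [Set.eq_univ_of_forall (s := _ ⁻¹' _) fun s => ?_, probReal_univ]
    simpa using Nat.lt_succ_of_le (exceedCount_le (s j) _)
  rw [Finset.sum_congr rfl fun r h => hconst r (Nat.lt_succ_iff.1 (Finset.mem_range.1 h))] at hsum
  rw [hconst r hr]
  simp only [Finset.sum_const, Finset.card_range, nsmul_eq_mul, Nat.cast_succ] at hsum
  rw [eq_div_iff (by positivity), mul_comm]
  exact hsum

end ScoreLaw

/-! ### Uniform ranks: monotone conditional probabilities and the step-up bound. -/

/-- The new term dominates every earlier one. Nonnegativity of `q 0` covers the empty average, which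
is `0 / 0 = 0`. -/
theorem monotone_average {q : ℕ → ℝ} (hq : Monotone q) (h0 : 0 ≤ q 0) :
    Monotone fun u : ℕ => (∑ r ∈ Finset.range u, q r) / (u : ℝ) := by
  refine monotone_nat_of_le_succ fun u => ?_
  rcases Nat.eq_zero_or_pos u with rfl | hu
  · simpa using h0
  have hu' : (0 : ℝ) < u := by exact_mod_cast hu
  have hsum : ∑ r ∈ Finset.range u, q r ≤ u * q u := by
    have := Finset.sum_le_card_nsmul (Finset.range u) q (q u)
      fun r hr => hq (Finset.mem_range.1 hr).le
    simpa using this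
  rw [Finset.sum_range_succ, Nat.cast_succ, div_le_div_iff₀ hu' (by positivity)]
  linarith

section RankVariable

variable {Ω : Type*} [MeasurableSpace Ω] {μ : Measure Ω} [IsProbabilityMeasure μ] {ℓ : ℕ}
  {N : Ω → ℕ}

theorem monotone_clamp {q : ℕ → ℝ} (h : ∀ r < ℓ, q r ≤ q (r + 1)) :
    Monotone fun r => q (min r ℓ) := by
  refine monotone_nat_of_le_succ fun r => ?_
  rcases lt_or_ge r ℓ with hr | hr
  · rw [min_eq_left hr.le, min_eq_left hr]
    exact h r hr
  · rw [min_eq_right hr, min_eq_right (hr.trans (Nat.le_succ r))]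

/-- If `N` is uniform on `{0, …, ℓ}` and the probability of `A` given `N = r` grows with `r`, then
`A` has a conditional probability given `(1 + N) / (ℓ + 1)` that is a monotone function of it. -/
theorem exists_monotone_condProb (hNm : Measurable N) (hN : ∀ ω, N ω ≤ ℓ)
    (hunif : ∀ r ≤ ℓ, μ.real (N ⁻¹' {r}) = 1 / ((ℓ : ℝ) + 1)) {A : Set Ω} (hA : MeasurableSet A)
    (hmono : ∀ r < ℓ, μ.real (N ⁻¹' {r} ∩ A) ≤ μ.real (N ⁻¹' {r + 1} ∩ A))
    {P : Ω → ℝ} (hP : ∀ ω, P ω = (1 + N ω) / ((ℓ : ℝ) + 1)) :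
    ∃ f : ℝ → ℝ, Monotone f ∧
      μ⟦A | MeasurableSpace.comap P inferInstance⟧ =ᵐ[μ] fun ω => f (P ω) := by
  have hℓ : (0 : ℝ) < (ℓ : ℝ) + 1 := by positivity
  have hPm : Measurable P := by
    rw [funext hP]
    exact ((measurable_from_nat (f := fun n : ℕ => (1 + (n : ℝ)) / ((ℓ : ℝ) + 1))).comp hNm)
  let q : ℕ → ℝ := fun r => μ.real (N ⁻¹' {r} ∩ A)
  -- The floor minus one recovers the rank from the p-value; clamping at `ℓ` keeps `f` monotone on
  -- all of `ℝ`. The factor `ℓ + 1` is the reciprocal of the probability of each rank.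
  let f : ℝ → ℝ := fun x => (ℓ + 1) * q (min (⌊x * (ℓ + 1)⌋₊ - 1) ℓ)
  have hf : Monotone f := fun x y hxy => mul_le_mul_of_nonneg_left
    (monotone_clamp (q := q) hmono (Nat.sub_le_sub_right (Nat.floor_mono (by gcongr)) 1)) hℓ.le
  have hfP : ∀ ω, f (P ω) = (ℓ + 1) * q (N ω) := by
    intro ω
    have : P ω * (ℓ + 1) = ((N ω + 1 : ℕ) : ℝ) := by
      rw [hP, div_mul_cancel₀ _ hℓ.ne']
      push_cast
      ring
    simp only [f]
    rw [this, Nat.floor_natCast, Nat.add_sub_cancel, min_eq_left (hN ω)]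
  refine ⟨f, hf, ?_⟩
  have hfPm : Measurable fun ω => f (P ω) := hf.measurable.comp hPm
  have hbd : ∀ ω, ‖f (P ω)‖ ≤ ℓ + 1 := by
    intro ω
    rw [hfP, Real.norm_of_nonneg (mul_nonneg hℓ.le measureReal_nonneg)]
    exact mul_le_of_le_one_right hℓ.le measureReal_le_one
  have hfint : Integrable (fun ω => f (P ω)) μ :=
    Integrable.of_bound hfPm.aestronglyMeasurable _ (Filter.Eventually.of_forall hbd)
  have hAint : Integrable (A.indicator fun _ => (1 : ℝ)) μ := (integrable_const 1).indicator hA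
  refine (ae_eq_condExp_of_forall_setIntegral_eq hPm.comap_le hAint
    (fun s _ _ => hfint.integrableOn) ?_
    (hf.measurable.comp (comap_measurable P)).aestronglyMeasurable).symm
  rintro s ⟨B, hB, rfl⟩ -
  -- An event in `σ(P)` is a finite union of rank events, so the integrals need comparing on each
  -- rank only.
  let T : Finset ℕ := (Finset.range (ℓ + 1)).filter fun r => (1 + (r : ℝ)) / ((ℓ : ℝ) + 1) ∈ B
  have hs : P ⁻¹' B = ⋃ r ∈ T, N ⁻¹' {r} := by
    ext ω
    simp [T, hP, hN ω]
  have hdisj : Set.Pairwise (T : Set ℕ) (Function.onFun Disjoint fun r => N ⁻¹' {r}) :=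
    fun r _ r' _ h => Disjoint.preimage N (Set.disjoint_singleton.2 h)
  have hmeas : ∀ r ∈ T, MeasurableSet (N ⁻¹' {r}) := fun r _ => hNm (measurableSet_singleton r)
  rw [hs, integral_biUnion_finset T hmeas hdisj fun r _ => hfint.integrableOn,
    integral_biUnion_finset T hmeas hdisj fun r _ => hAint.integrableOn]
  refine Finset.sum_congr rfl fun r hr => ?_
  have hrℓ : r ≤ ℓ := by
    simp only [T, Finset.mem_filter, Finset.mem_range] at hr
    omega
  have h1 : ∫ ω in N ⁻¹' {r}, f (P ω) ∂μ = ∫ ω in N ⁻¹' {r}, (ℓ + 1) * q r ∂μ := by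
    refine setIntegral_congr_fun (hmeas r hr) fun ω hω => ?_
    have : N ω = r := hω
    simp only [hfP, this]
  rw [h1, setIntegral_const, hunif r hrℓ, integral_indicator hA, Measure.restrict_restrict hA,
    setIntegral_const, Set.inter_comm A, smul_eq_mul, smul_eq_mul]
  simp only [q]
  field_simp

theorem measureReal_inter_lt_eq_sum (hNm : Measurable N) {A : Set Ω} (hA : MeasurableSet A) (u : ℕ) :
    μ.real (A ∩ {ω | N ω < u}) = ∑ r ∈ Finset.range u, μ.real (N ⁻¹' {r} ∩ A) := by
  have h : A ∩ {ω | N ω < u} = ⋃ r ∈ Finset.range u, N ⁻¹' {r} ∩ A := by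
    ext ω
    simp [and_comm]
  rw [h, measureReal_biUnion_finset]
  · exact fun r _ r' _ h => (Disjoint.preimage N (Set.disjoint_singleton.2 h)).mono
      Set.inter_subset_left Set.inter_subset_left
  · exact fun r _ => (hNm (measurableSet_singleton r)).inter hA

/-- The contribution of one true null to the false discovery rate of a step-up procedure: `R` is
the number of rejections and `P` the p-value of the null. -/
theorem sum_rejection_prob_le (hNm : Measurable N) (hN : ∀ ω, N ω ≤ ℓ)
    (hunif : ∀ r ≤ ℓ, μ.real (N ⁻¹' {r}) = 1 / ((ℓ : ℝ) + 1)) {R : Ω → ℕ} (hR : Measurable R)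
    (hmono : ∀ k, ∀ r < ℓ,
      μ.real (N ⁻¹' {r} ∩ {ω | R ω ≤ k}) ≤ μ.real (N ⁻¹' {r + 1} ∩ {ω | R ω ≤ k}))
    {P : Ω → ℝ} (hP : ∀ ω, P ω = (1 + N ω) / ((ℓ : ℝ) + 1)) {β : ℝ} (hβ : 0 ≤ β) (M : ℕ) :
    ∑ k ∈ Finset.range M, μ.real ({ω | R ω = k + 1} ∩ {ω | P ω ≤ β * (k + 1 : ℕ)}) * (1 / (k + 1 : ℕ))
      ≤ β := by
  have hℓ : (0 : ℝ) < (ℓ : ℝ) + 1 := by positivity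
  -- `u l` counts the ranks whose p-value is at most `β * l`; the cap reflects that there are `ℓ +
  -- 1` ranks.
  let u : ℕ → ℕ := fun l => min ⌊β * l * (ℓ + 1)⌋₊ (ℓ + 1)
  have hu : Monotone u := fun k l h => min_le_min_right _ (Nat.floor_mono (by gcongr))
  have hu_le : ∀ l, (u l : ℝ) ≤ β * l * (ℓ + 1) := fun l =>
    (Nat.cast_le.2 (min_le_left _ _)).trans (Nat.floor_le (by positivity))
  have hPu : ∀ l : ℕ, {ω | P ω ≤ β * l} = {ω | N ω < u l} := by
    intro l
    ext ω
    have h1 : (1 + (N ω : ℝ)) = ((N ω + 1 : ℕ) : ℝ) := by push_cast; ring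
    have h2 := hN ω
    simp only [Set.mem_ofPred_eq, u, lt_min_iff]
    rw [hP, div_le_iff₀ hℓ, h1, ← Nat.le_floor_iff (by positivity)]
    omega
  let q : ℕ → ℕ → ℝ := fun k r => μ.real (N ⁻¹' {r} ∩ {ω | R ω ≤ k})
  have hRm : ∀ k, MeasurableSet {ω | R ω ≤ k} := fun k => hR measurableSet_Iic
  have hq0 : ∀ k r, 0 ≤ q k r := fun k r => measureReal_nonneg
  have hqk : ∀ r, Monotone fun k => q k r := fun r k l h =>
    measureReal_mono (Set.inter_subset_inter_right _ fun ω (hω : R ω ≤ k) => hω.trans h)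
  have hq1 : ∀ k, ∀ r ≤ ℓ, q k r ≤ 1 / (ℓ + 1) := fun k r hr =>
    (measureReal_mono Set.inter_subset_left).trans_eq (hunif r hr)
  -- By uniformity, `(ℓ + 1) * h k l` is the probability of `R ≤ k` given `N < u l` whenever `u l >
  -- 0`.
  let h : ℕ → ℕ → ℝ := fun k l => (∑ r ∈ Finset.range (u l), q k r) / (u l : ℝ)
  have hhu : ∀ k l, μ.real ({ω | R ω ≤ k} ∩ {ω | N ω < u l}) = u l * h k l := by
    intro k l
    rw [measureReal_inter_lt_eq_sum hNm (hRm k)]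
    simp only [h]
    rcases Nat.eq_zero_or_pos (u l) with h0 | h0
    · simp [h0]
    · rw [mul_div_cancel₀]
      exact_mod_cast h0.ne'
  have hh_right : ∀ k, Monotone (h k) := by
    intro k
    have heq : h k = (fun v : ℕ => (∑ r ∈ Finset.range v, q k (min r ℓ)) / (v : ℝ)) ∘ u := by
      funext l
      simp only [h, Function.comp_apply]
      congr 1
      refine Finset.sum_congr rfl fun r hr => ?_
      have : u l ≤ ℓ + 1 := min_le_right _ _
      rw [min_eq_left]
      rw [Finset.mem_range] at hr
      omega
    rw [heq]
    exact (monotone_average (monotone_clamp (hmono k)) (hq0 _ _)).comp hu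
  have hh_left : ∀ l, Monotone fun k => h k l := fun l k k' hk =>
    div_le_div_of_nonneg_right (Finset.sum_le_sum fun r _ => hqk r hk) (Nat.cast_nonneg _)
  have hh1 : ∀ k l, (ℓ + 1) * h k l ≤ 1 := by
    intro k l
    rcases Nat.eq_zero_or_pos (u l) with h0 | h0
    · simp [h, h0]
    have h0' : (0 : ℝ) < u l := by exact_mod_cast h0
    have hs : ∑ r ∈ Finset.range (u l), q k r ≤ u l * (1 / (ℓ + 1)) := by
      have := Finset.sum_le_card_nsmul (Finset.range (u l)) (q k) (1 / (ℓ + 1)) fun r hr => ?_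
      · simpa using this
      · have : u l ≤ ℓ + 1 := min_le_right _ _
        rw [Finset.mem_range] at hr
        exact hq1 k r (by omega)
    have : h k l ≤ 1 / (ℓ + 1) := by
      simp only [h]
      rw [div_le_iff₀ h0']
      linarith
    rw [le_div_iff₀ hℓ] at this
    linarith
  have hterm : ∀ k : ℕ,
      μ.real ({ω | R ω = k + 1} ∩ {ω | P ω ≤ β * (k + 1 : ℕ)}) * (1 / (k + 1 : ℕ))
      ≤ β * (ℓ + 1) * (h (k + 1) (k + 1) - h k k) := by
    intro k
    have hk : (0 : ℝ) < (k + 1 : ℕ) := by positivity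
    have hsplit : μ.real ({ω | R ω = k + 1} ∩ {ω | P ω ≤ β * (k + 1 : ℕ)}) =
        u (k + 1) * (h (k + 1) (k + 1) - h k (k + 1)) := by
      rw [hPu, mul_sub, ← hhu, ← hhu, eq_sub_iff_add_eq, ← measureReal_union]
      · congr 1
        ext ω
        simp only [Set.mem_union, Set.mem_inter_iff, Set.mem_ofPred_eq]
        omega
      · rw [Set.disjoint_left]
        rintro ω ⟨h1, -⟩ ⟨h2, -⟩
        simp only [Set.mem_ofPred_eq] at h1 h2
        omega
      · exact (hRm k).inter (hNm measurableSet_Iio)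
    rw [hsplit, mul_one_div, div_le_iff₀ hk]
    have h1 : 0 ≤ h (k + 1) (k + 1) - h k (k + 1) := sub_nonneg.2 (hh_left _ (Nat.le_succ k))
    -- Positive dependence enters here: relaxing the p-value threshold raises the conditional
    -- probability of `R ≤ k`, which makes the bound telescope.
    have h2 : h k k ≤ h k (k + 1) := hh_right k (Nat.le_succ k)
    calc u (k + 1) * (h (k + 1) (k + 1) - h k (k + 1))
        ≤ (β * (k + 1 : ℕ) * (ℓ + 1)) * (h (k + 1) (k + 1) - h k (k + 1)) :=
          mul_le_mul_of_nonneg_right (hu_le _) h1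
      _ ≤ (β * (k + 1 : ℕ) * (ℓ + 1)) * (h (k + 1) (k + 1) - h k k) := by gcongr
      _ = _ := by ring
  have h00 : 0 ≤ h 0 0 := div_nonneg (Finset.sum_nonneg fun r _ => hq0 _ _) (Nat.cast_nonneg _)
  calc _ ≤ ∑ k ∈ Finset.range M, β * (ℓ + 1) * (h (k + 1) (k + 1) - h k k) :=
        Finset.sum_le_sum fun k _ => hterm k
    _ = β * ((ℓ + 1) * h M M - (ℓ + 1) * h 0 0) := by
        rw [← Finset.mul_sum, Finset.sum_range_sub fun k => h k k]
        ring
    _ ≤ β * 1 := by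
        gcongr
        have := hh1 M M
        have := mul_nonneg hℓ.le h00
        linarith
    _ = β := mul_one β

end RankVariable

/-! ### Monotonicity of FastLSU and decomposition of the false discovery proportion. -/

section FastLSU

variable {K : ℕ} {m : Fin K → ℕ}

theorem fastLSUStep_antitone {p p' : (j : Fin K) → Fin (m j) → ℝ} (h : ∀ j t, p j t ≤ p' j t)
    (α : ℝ) (r : ℕ) : fastLSUStep p' α r ≤ fastLSUStep p α r := by
  refine Finset.sum_le_sum fun j _ => Finset.card_le_card fun t ht => ?_
  simp only [Finset.mem_filter, Finset.mem_univ, true_and] at ht ⊢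
  exact (h j t).trans ht

/-- Both iterations start from the same `M`, so comparing single steps suffices. This makes `R ≤ k`
an increasing event. -/
theorem fastLSUCount_antitone {p p' : (j : Fin K) → Fin (m j) → ℝ} (h : ∀ j t, p j t ≤ p' j t)
    {α : ℝ} (hα : 0 ≤ α) : fastLSUCount p' α ≤ fastLSUCount p α :=
  (fastLSUStep_mono p' hα).iterate_le_of_le (fastLSUStep_antitone h α) _ _

theorem fastLSUCount_le (p : (j : Fin K) → Fin (m j) → ℝ) {α : ℝ} (hα : 0 ≤ α) :
    fastLSUCount p α ≤ totalTests m := by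
  rw [← fastLSUCount_stable p hα]
  exact fastLSUStep_le p α _

theorem sum_card_fastLSURejections (p : (j : Fin K) → Fin (m j) → ℝ) {α : ℝ} (hα : 0 ≤ α) :
    ∑ j, (fastLSURejections p α j).card = fastLSUCount p α :=
  fastLSUCount_stable p hα

/-- By stationarity the count equals the number of rejections, so slicing by its value `k + 1` makes
the denominator constant. A zero count means no rejections. -/
theorem globalFDP_fastLSURejections (H0 : (j : Fin K) → Set (Fin (m j)))
    (p : (j : Fin K) → Fin (m j) → ℝ) {α : ℝ} (hα : 0 ≤ α) :
    globalFDP H0 (fastLSURejections p α) =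
      ∑ x : (j : Fin K) × Fin (m j), if x.2 ∈ H0 x.1 then
        ∑ k ∈ Finset.range (totalTests m),
          if fastLSUCount p α = k + 1 ∧ p x.1 x.2 ≤ α / totalTests m * (k + 1 : ℕ)
            then (1 / (k + 1 : ℕ) : ℝ) else 0
      else 0 := by
  have hR := sum_card_fastLSURejections p hα
  have hRr : ∑ j, ((fastLSURejections p α j).card : ℝ) = fastLSUCount p α := by
    exact_mod_cast hR
  unfold globalFDP
  rw [hRr]
  rcases hc : fastLSUCount p α with _ | r
  · rw [hc, Finset.sum_eq_zero_iff] at hR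
    have : ∀ j, fastLSURejections p α j = ∅ := fun j =>
      Finset.card_eq_zero.1 (hR j (Finset.mem_univ j))
    simp [this]
  · have hr : r < totalTests m := by
      have := fastLSUCount_le p hα
      omega
    rw [max_eq_left (by push_cast; linarith [(Nat.cast_nonneg r : (0 : ℝ) ≤ r)]),
      Finset.sum_div, Fintype.sum_sigma]
    refine Finset.sum_congr rfl fun j _ => ?_
    rw [Finset.card_filter, Nat.cast_sum, Finset.sum_div, fastLSURejections, Finset.sum_filter]
    refine Finset.sum_congr rfl fun t _ => ?_
    rw [Finset.sum_eq_single r]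
    · have : α * ((r + 1 : ℕ) : ℝ) / totalTests m = α / totalTests m * ((r + 1 : ℕ) : ℝ) := by ring
      rw [hc, this]
      by_cases h1 : t ∈ H0 j <;> simp [h1]
    · intro k _ hk
      exact if_neg fun h => hk (by omega)
    · exact fun h => absurd (Finset.mem_range.2 hr) h

end FastLSU

/-! ### From exchangeability given the novelties to invariance of laws. -/

section Exchangeability

variable {Ω E : Type*} [MeasurableSpace Ω] [MeasurableSpace E] {μ : Measure Ω}
  [IsProbabilityMeasure μ]

/-- Conditional exchangeability gives equality of the joint laws of the permuted family and the
conditioning family. -/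
theorem CondExchangeable.map_prod_eq {ι κ : Type*} {U : ι → Ω → E} {V : κ → Ω → E}
    (h : CondExchangeable μ U V) (hU : ∀ i, Measurable (U i)) (hV : ∀ t, Measurable (V t))
    (π : Equiv.Perm ι) :
    μ.map (fun ω => ((fun i => U (π i) ω), fun t => V t ω)) =
      μ.map (fun ω => ((fun i => U i ω), fun t => V t ω)) := by
  have hUm : Measurable fun ω i => U i ω := measurable_pi_lambda _ hU
  have hUπ : Measurable fun ω i => U (π i) ω := measurable_pi_lambda _ fun i => hU (π i)
  have hVm : Measurable fun ω t => V t ω := measurable_pi_lambda _ hV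
  have : IsProbabilityMeasure (μ.map (fun ω => ((fun i => U (π i) ω), fun t => V t ω))) :=
    Measure.isProbabilityMeasure_map (hUπ.prodMk hVm).aemeasurable
  refine Measure.ext_prod fun {A B} hA hB => ?_
  rw [Measure.map_apply (hUπ.prodMk hVm) (hA.prod hB),
    Measure.map_apply (hUm.prodMk hVm) (hA.prod hB), ← measureReal_eq_measureReal_iff]
  -- On a rectangle the joint probability is the integral of the conditional probability of `A` over
  -- the event `V ∈ B`.
  have key : ∀ W : Ω → ι → E, Measurable W →
      μ.real ((fun ω => (W ω, fun t => V t ω)) ⁻¹' A ×ˢ B) =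
        ∫ ω in (fun ω t => V t ω) ⁻¹' B,
          (μ⟦W ⁻¹' A | MeasurableSpace.comap (fun ω t => V t ω) inferInstance⟧) ω ∂μ := by
    intro W hW
    rw [setIntegral_condExp hVm.comap_le ((integrable_const 1).indicator (hW hA)) ⟨B, hB, rfl⟩,
      integral_indicator (hW hA), Measure.restrict_restrict (hW hA), setIntegral_const, smul_eq_mul,
      mul_one]
    rfl
  rw [key _ hUπ, key _ hUm]
  exact setIntegral_congr_ae (hVm hB) ((h π A hA).mono fun ω hω _ => hω)

theorem mem_nullPositions_testIdx {k ℓ m : ℕ} {H0 : Set (Fin m)} {t : Fin m} :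
    (testIdx t : BlockIdx k ℓ m) ∈ nullPositions (k := k) (ℓ := ℓ) H0 ↔ t ∈ H0 := by
  simp [nullPositions]

theorem mem_nullPositions_calIdx {k ℓ m : ℕ} {H0 : Set (Fin m)} (c : Fin ℓ) :
    (calIdx c : BlockIdx k ℓ m) ∈ nullPositions (k := k) (ℓ := ℓ) H0 := by
  simp [nullPositions]

/-- Both exchanged positions are null, so the exchange permutes the null family and fixes the
novelties. The block is a measurable function of these two families. -/
theorem map_block_swap {k ℓ m : ℕ} {H0 : Set (Fin m)} {Z : BlockIdx k ℓ m → Ω → E}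
    (hZ : ∀ x, Measurable (Z x))
    (hexch : CondExchangeable μ
      (fun x : {x // x ∈ nullPositions (k := k) (ℓ := ℓ) H0} => Z x.1)
      (fun t : {t // t ∉ H0} => Z (testIdx t.1))) {t : Fin m} (ht : t ∈ H0) (c : Fin ℓ) :
    μ.map (fun ω x => Z (Equiv.swap (testIdx t) (calIdx c) x) ω) = μ.map fun ω x => Z x ω := by
  let N := nullPositions (k := k) (ℓ := ℓ) H0
  have hx : ∀ x : BlockIdx k ℓ m, x ∉ N → ∃ u : {u // u ∉ H0}, x = testIdx u.1 := by
    intro x hx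
    simp only [N, nullPositions, Set.mem_ofPred_eq, not_forall] at hx
    obtain ⟨u, hu, hu'⟩ := hx
    exact ⟨⟨u, hu'⟩, hu⟩
  let merge : (N → E) × ({u // u ∉ H0} → E) → BlockIdx k ℓ m → E := fun w x =>
    if h : x ∈ N then w.1 ⟨x, h⟩ else w.2 (hx x h).choose
  have hmerge : Measurable merge := by
    refine measurable_pi_lambda _ fun x => ?_
    by_cases h : x ∈ N
    · simp only [merge, h, dif_pos]
      exact (measurable_pi_apply _).comp measurable_fst
    · simp only [merge, h, dif_neg, not_false_eq_true]
      exact (measurable_pi_apply _).comp measurable_snd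
  let a : N := ⟨testIdx t, mem_nullPositions_testIdx.2 ht⟩
  let b : N := ⟨calIdx c, mem_nullPositions_calIdx c⟩
  have hswap : ∀ y : N, (Equiv.swap a b y).1 = Equiv.swap (testIdx t) (calIdx c) y.1 := by
    intro y
    simp only [Equiv.swap_apply_def, Subtype.ext_iff, a, b]
    split_ifs <;> rfl
  have h1 : (fun ω x => Z (Equiv.swap (testIdx t) (calIdx c) x) ω) = merge ∘ fun ω =>
      ((fun y : N => Z (Equiv.swap a b y).1 ω), fun u : {u // u ∉ H0} => Z (testIdx u.1) ω) := by
    funext ω x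
    by_cases h : x ∈ N
    · simp only [merge, Function.comp_apply, dif_pos h, hswap]
    · simp only [merge, Function.comp_apply, dif_neg h]
      rw [← (hx x h).choose_spec, Equiv.swap_apply_of_ne_of_ne]
      · exact fun e => h (e ▸ a.2)
      · exact fun e => h (e ▸ b.2)
  have h2 : (fun ω x => Z x ω) = merge ∘ fun ω =>
      ((fun y : N => Z y.1 ω), fun u : {u // u ∉ H0} => Z (testIdx u.1) ω) := by
    funext ω x
    by_cases h : x ∈ N
    · simp only [merge, Function.comp_apply, dif_pos h]
    · simp only [merge, Function.comp_apply, dif_neg h]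
      rw [← (hx x h).choose_spec]
  have hV : Measurable fun ω (u : {u // u ∉ H0}) => Z (testIdx u.1) ω :=
    measurable_pi_lambda _ fun u => hZ _
  have hU : ∀ π : Equiv.Perm N, Measurable fun ω (y : N) => Z (π y).1 ω :=
    fun π => measurable_pi_lambda _ fun y => hZ _
  rw [h1, h2, ← Measure.map_map hmerge ((hU (Equiv.swap a b)).prodMk hV)]
  refine Eq.trans ?_ (Measure.map_map hmerge ((hU 1).prodMk hV))
  exact congrArg (Measure.map merge)
    (hexch.map_prod_eq (fun y => hZ y.1) (fun u => hZ _) (Equiv.swap a b))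

end Exchangeability

theorem measurePreserving_pi_update {ι : Type*} [Fintype ι] [DecidableEq ι] {β : ι → Type*}
    [∀ i, MeasurableSpace (β i)] (ν : (i : ι) → Measure (β i)) [∀ i, IsProbabilityMeasure (ν i)]
    (i : ι) {f : β i → β i} (hf : MeasurePreserving f (ν i) (ν i)) :
    MeasurePreserving (fun x => Function.update x i (f (x i))) (Measure.pi ν) (Measure.pi ν) := by
  have h : ∀ j, MeasurePreserving (Function.update (fun j => (id : β j → β j)) i f j) (ν j) (ν j) := by
    intro j
    by_cases hj : j = i
    · subst hj
      simpa using hf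
    · simpa [Function.update_of_ne hj] using MeasurePreserving.id (ν j)
  convert measurePreserving_pi ν ν h using 1
  funext x j
  by_cases hj : j = i
  · subst hj
    simp
  · simp [Function.update_of_ne hj]

/-! ### The exchange on the data of the whole network. -/

section Network

variable {K : ℕ} {k ℓ m : Fin K → ℕ} {E : Type*}

/-- Exchange of test position `t` and calibration position `c` in the evaluation block of
agent `j`. -/
def swapData (j : Fin K) (t : Fin (m j)) (c : Fin (ℓ j))
    (d : (a _ : Fin K) → BlockIdx (k a) (ℓ a) (m a) → E) :
    (a _ : Fin K) → BlockIdx (k a) (ℓ a) (m a) → E :=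
  Function.update d j (Function.update (d j) j (d j j ∘ Equiv.swap (testIdx t) (calIdx c)))

/-- The composite scores of the calibration and test samples of all agents. -/
noncomputable def scoreFamily (g : (a : Fin K) → E → (BlockIdx (k a) (ℓ a) (m a) → E) → ℝ)
    (d : (a _ : Fin K) → BlockIdx (k a) (ℓ a) (m a) → E) (j : Fin K) :
    Fin (ℓ j) ⊕ Fin (m j) → ℝ :=
  fun x => compositeScore g j (fun a y => d a j y) (d j j (Sum.inr x))

theorem pValue_eq_pValueFamily (g : (a : Fin K) → E → (BlockIdx (k a) (ℓ a) (m a) → E) → ℝ)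
    (d : (a _ : Fin K) → BlockIdx (k a) (ℓ a) (m a) → E) (x : (j : Fin K) × Fin (m j)) :
    pValue g x.1 (fun a y => d a x.1 y) x.2 = pValueFamily (scoreFamily g d) x := by
  simp only [pValue, pValueFamily, conformalPValue, exceedCount, scoreFamily]
  rw [one_div_mul_eq_div, Finset.sum_boole]
  rfl

/-- Only the block of `j` designated for itself is altered. It enters the composite score of `j`
alone, and there the fitted score is unchanged by the permutation. -/
theorem scoreFamily_swapData {g : (a : Fin K) → E → (BlockIdx (k a) (ℓ a) (m a) → E) → ℝ}
    (hginv : ∀ a z (h : BlockIdx (k a) (ℓ a) (m a) → E)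
      (π : Equiv.Perm (Fin (ℓ a) ⊕ Fin (m a))), g a z (h ∘ Sum.map id π) = g a z h)
    (j : Fin K) (t : Fin (m j)) (c : Fin (ℓ j))
    (d : (a _ : Fin K) → BlockIdx (k a) (ℓ a) (m a) → E) :
    scoreFamily g (swapData j t c d) = swapScores j t c (scoreFamily g d) := by
  have hσ : (Equiv.swap (testIdx t) (calIdx c) : BlockIdx (k j) (ℓ j) (m j) → _) =
      Sum.map id (Equiv.swap (Sum.inr t) (Sum.inl c)) := by
    funext x
    rcases x with x | x
    · simp [Equiv.swap_apply_of_ne_of_ne]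
    · simp only [Equiv.swap_apply_def, Sum.map_inr, Sum.inr.injEq]
      split_ifs <;> rfl
  funext i x
  by_cases hi : i = j
  · subst hi
    have hscore : ∀ z, compositeScore g i (fun a y => swapData i t c d a i y) z =
        compositeScore g i (fun a y => d a i y) z := by
      intro z
      unfold compositeScore
      refine Finset.sup'_congr _ rfl fun a _ => ?_
      by_cases ha : a = i
      · subst ha
        simp only [swapData, Function.update_self]
        rw [hσ]
        exact hginv a z (d a a) _
      · simp [swapData, Function.update_of_ne ha]
    simp only [scoreFamily, hscore, swapScores, Function.update_self, Function.comp_apply]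
    congr 1
    simp only [swapData, Function.update_self, Function.comp_apply]
    rw [hσ]
    rfl
  · have h : ∀ a, swapData j t c d a i = d a i := by
      intro a
      by_cases ha : a = j
      · subst ha
        simp [swapData, Function.update_of_ne hi]
      · simp [swapData, Function.update_of_ne ha]
    simp only [scoreFamily, h, swapScores, Function.update_of_ne hi]

variable [MeasurableSpace E]

theorem measurable_scoreFamily {g : (a : Fin K) → E → (BlockIdx (k a) (ℓ a) (m a) → E) → ℝ}
    (hg : ∀ a, Measurable (Function.uncurry (g a))) : Measurable (scoreFamily g) := by
  refine measurable_pi_lambda _ fun j => measurable_pi_lambda _ fun x => ?_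
  unfold scoreFamily compositeScore
  have h : ∀ a ∈ (Finset.univ : Finset (Fin K)),
      Measurable fun d : (a _ : Fin K) → BlockIdx (k a) (ℓ a) (m a) → E =>
        g a (d j j (Sum.inr x)) (fun y => d a j y) := by
    intro a _
    have : Measurable fun d : (a _ : Fin K) → BlockIdx (k a) (ℓ a) (m a) → E =>
        (d j j (Sum.inr x), fun y => d a j y) := by fun_prop
    exact (hg a).comp this
  convert Finset.measurable_sup' ⟨j, Finset.mem_univ j⟩ h using 1
  funext d
  exact (Finset.sup'_apply (C := fun _ => ℝ) ⟨j, Finset.mem_univ j⟩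
    (fun a (d : (a _ : Fin K) → BlockIdx (k a) (ℓ a) (m a) → E) =>
      g a (d j j (Sum.inr x)) (fun y => d a j y)) d).symm

theorem measurable_swapScores (j : Fin K) (t : Fin (m j)) (c : Fin (ℓ j)) :
    Measurable (swapScores (ℓ := ℓ) (m := m) j t c) := by
  unfold swapScores
  refine measurable_pi_lambda _ fun i => ?_
  by_cases hi : i = j
  · subst hi
    simp only [Function.update_self]
    exact measurable_pi_lambda _ fun x => by
      simp only [Function.comp_apply]
      fun_prop
  · simp only [Function.update_of_ne hi]
    fun_prop

variable {Ω : Type*} [MeasurableSpace Ω] {μ : Measure Ω} [IsProbabilityMeasure μ]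

/-- The law is a product over agents, and the factor of `j` a product over blocks; the exchange acts
on a single factor at each level. -/
theorem measurePreserving_swapData {Z : (a b : Fin K) → BlockIdx (k a) (ℓ a) (m a) → Ω → E}
    (hZ : ∀ a b x, Measurable (Z a b x))
    (hagents : iIndepFun (fun (a : Fin K) (ω : Ω) =>
      (fun b x => Z a b x ω : Fin K → BlockIdx (k a) (ℓ a) (m a) → E)) μ)
    (hblocks : ∀ a, iIndepFun (fun (b : Fin K) (ω : Ω) =>
      (fun x => Z a b x ω : BlockIdx (k a) (ℓ a) (m a) → E)) μ)
    {j : Fin K} {t : Fin (m j)} {c : Fin (ℓ j)}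
    (hswap : μ.map (fun ω x => Z j j (Equiv.swap (testIdx t) (calIdx c) x) ω) =
      μ.map fun ω x => Z j j x ω) :
    MeasurePreserving (swapData j t c) (μ.map fun ω a b x => Z a b x ω)
      (μ.map fun ω a b x => Z a b x ω) := by
  have hblock : ∀ a b, Measurable fun ω x => Z a b x ω :=
    fun a b => measurable_pi_lambda _ (hZ a b)
  have hrow : ∀ a, Measurable fun ω b x => Z a b x ω := fun a => measurable_pi_lambda _ (hblock a)
  rw [hagents.map_fun_eq_pi_map fun a => (hrow a).aemeasurable]
  have : ∀ a, IsProbabilityMeasure (μ.map fun ω b x => Z a b x ω) :=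
    fun a => Measure.isProbabilityMeasure_map (hrow a).aemeasurable
  have : ∀ b, IsProbabilityMeasure (μ.map fun ω x => Z j b x ω) :=
    fun b => Measure.isProbabilityMeasure_map (hblock j b).aemeasurable
  refine measurePreserving_pi_update (fun a => μ.map fun ω b x => Z a b x ω) j
    (f := fun r => Function.update r j (r j ∘ Equiv.swap (testIdx t) (calIdx c))) ?_
  rw [(hblocks j).map_fun_eq_pi_map fun b => (hblock j b).aemeasurable]
  have hσ : Measurable fun h : BlockIdx (k j) (ℓ j) (m j) → E =>
      h ∘ Equiv.swap (testIdx t) (calIdx c) :=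
    measurable_pi_lambda _ fun x => measurable_pi_apply _
  refine measurePreserving_pi_update (fun b => μ.map fun ω x => Z j b x ω) j
    (f := fun h => h ∘ Equiv.swap (testIdx t) (calIdx c)) ⟨hσ, ?_⟩
  rw [Measure.map_map hσ (hblock j j)]
  exact hswap

end Network

/-! ### PRDS and FDR control for random scores. -/

section ScoreMeasure

variable {K : ℕ} {ℓ m : Fin K → ℕ} {Ω : Type*} [MeasurableSpace Ω] {μ : Measure Ω}
  [IsProbabilityMeasure μ] {S : Ω → (j : Fin K) → Fin (ℓ j) ⊕ Fin (m j) → ℝ}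
  {H0 : (j : Fin K) → Set (Fin (m j))}

theorem measureReal_exceedCount_comp (hS : Measurable S)
    (hinj : ∀ j, ∀ᵐ ω ∂μ, Function.Injective (S ω j))
    (hswap : ∀ j, ∀ t ∈ H0 j, ∀ c, MeasurePreserving (swapScores j t c) (μ.map S) (μ.map S))
    {j : Fin K} {t : Fin (m j)} (ht : t ∈ H0 j) :
    (∀ r ≤ ℓ j, μ.real ((fun ω => exceedCount (S ω j) (S ω j (Sum.inr t))) ⁻¹' {r}) =
      1 / ((ℓ j : ℝ) + 1)) ∧
    ∀ D : Set ((j : Fin K) × Fin (m j) → ℝ), IsUpperSet D → ∀ r < ℓ j,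
      μ.real ((fun ω => exceedCount (S ω j) (S ω j (Sum.inr t))) ⁻¹' {r} ∩
          (fun ω => pValueFamily (S ω)) ⁻¹' D) ≤
        μ.real ((fun ω => exceedCount (S ω j) (S ω j (Sum.inr t))) ⁻¹' {r + 1} ∩
          (fun ω => pValueFamily (S ω)) ⁻¹' D) := by
  have : IsProbabilityMeasure (μ.map S) := Measure.isProbabilityMeasure_map hS.aemeasurable
  have hcount : ∀ r, MeasurableSet {s : (j : Fin K) → Fin (ℓ j) ⊕ Fin (m j) → ℝ |
      exceedCount (s j) (s j (Sum.inr t)) = r} := fun r =>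
    ((measurable_exceedCount t).comp (measurable_pi_apply j)) (measurableSet_singleton r)
  have hinjm : ∀ᵐ s ∂μ.map S, Function.Injective (s j) := by
    refine (ae_map_iff hS.aemeasurable ?_).2 (hinj j)
    simp only [Function.Injective, Set.ofPred_forall]
    refine MeasurableSet.iInter fun x => MeasurableSet.iInter fun y => ?_
    by_cases hxy : x = y
    · simp [hxy]
    · simp only [hxy, imp_false]
      exact (measurableSet_eq_fun (by fun_prop) (by fun_prop)).compl
  refine ⟨fun r hr => ?_, fun D hD r hr => ?_⟩
  · rw [← measureReal_exceedCount hinjm (hswap j t ht) hr, map_measureReal_apply hS (hcount r)]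
    rfl
  · have h := measure_exceedCount_inter_upperSet_le hinjm (hswap j t ht) hD hr
    have hDm := measurableSet_pValueFamily_preimage (ℓ := ℓ) D
    rw [Measure.map_apply hS ((hcount _).inter hDm),
      Measure.map_apply hS ((hcount _).inter hDm)] at h
    exact ENNReal.toReal_mono (measure_ne_top _ _) h

theorem measurable_pValueFamily_comp (hS : Measurable S) (x : (j : Fin K) × Fin (m j)) :
    Measurable fun ω => pValueFamily (S ω) x := fun B _ =>
  hS (measurableSet_pValueFamily_preimage {p | p x ∈ B})

theorem isPRDS_pValueFamily (hS : Measurable S)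
    (hinj : ∀ j, ∀ᵐ ω ∂μ, Function.Injective (S ω j))
    (hswap : ∀ j, ∀ t ∈ H0 j, ∀ c, MeasurePreserving (swapScores j t c) (μ.map S) (μ.map S)) :
    IsPRDS μ (fun x ω => pValueFamily (S ω) x) {x | x.2 ∈ H0 x.1} := by
  refine ⟨measurable_pValueFamily_comp hS, fun D hD hDm x hx => ?_⟩
  obtain ⟨h1, h2⟩ := measureReal_exceedCount_comp hS hinj hswap hx
  exact exists_monotone_condProb
    ((measurable_exceedCount x.2).comp ((measurable_pi_apply x.1).comp hS))
    (fun ω => exceedCount_le _ _) h1 hDm (h2 D hD) fun ω => rfl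

theorem globalFDP_pValueFamily_le (hS : Measurable S)
    (hinj : ∀ j, ∀ᵐ ω ∂μ, Function.Injective (S ω j))
    (hswap : ∀ j, ∀ t ∈ H0 j, ∀ c, MeasurePreserving (swapScores j t c) (μ.map S) (μ.map S))
    {α : ℝ} (hα : 0 ≤ α) :
    Integrable (fun ω => globalFDP H0 (fastLSURejections
      (fun j t => pValueFamily (S ω) ⟨j, t⟩) α)) μ ∧
    ∫ ω, globalFDP H0 (fastLSURejections
      (fun j t => pValueFamily (S ω) ⟨j, t⟩) α) ∂μ ≤ α := by
  let R : Ω → ℕ := fun ω => fastLSUCount (fun j t => pValueFamily (S ω) ⟨j, t⟩) α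
  let M := totalTests m
  have hRm : Measurable R := fun B _ => hS (measurableSet_pValueFamily_preimage
    {p | fastLSUCount (fun j t => p ⟨j, t⟩) α ∈ B})
  let A : (j : Fin K) × Fin (m j) → ℕ → Set Ω := fun x k =>
    {ω | R ω = k + 1} ∩ {ω | pValueFamily (S ω) x ≤ α / M * (k + 1 : ℕ)}
  have hA : ∀ x k, MeasurableSet (A x k) := fun x k =>
    (hRm (measurableSet_singleton (k + 1))).inter
      (measurableSet_le (measurable_pValueFamily_comp hS x) measurable_const)
  have hFDP : (fun ω => globalFDP H0 (fastLSURejections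
      (fun j t => pValueFamily (S ω) ⟨j, t⟩) α)) = fun ω =>
      ∑ x ∈ Finset.univ.filter fun x : (j : Fin K) × Fin (m j) => x.2 ∈ H0 x.1,
        ∑ k ∈ Finset.range M, (A x k).indicator (fun _ => (1 / (k + 1 : ℕ) : ℝ)) ω := by
    funext ω
    rw [globalFDP_fastLSURejections H0 _ hα, Finset.sum_filter]
    refine Finset.sum_congr rfl fun x _ => ?_
    congr 1
    refine Finset.sum_congr rfl fun k _ => ?_
    rw [Set.indicator_apply]
    rfl
  have hint : ∀ x k, Integrable ((A x k).indicator fun _ => (1 / (k + 1 : ℕ) : ℝ)) μ :=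
    fun x k => (integrable_const _).indicator (hA x k)
  rw [hFDP]
  refine ⟨integrable_finsetSum _ fun x _ => integrable_finsetSum _ fun k _ => hint x k, ?_⟩
  rw [integral_finsetSum _ fun x _ => integrable_finsetSum _ fun k _ => hint x k]
  have hx : ∀ x ∈ Finset.univ.filter fun x : (j : Fin K) × Fin (m j) => x.2 ∈ H0 x.1,
      ∫ ω, ∑ k ∈ Finset.range M, (A x k).indicator (fun _ => (1 / (k + 1 : ℕ) : ℝ)) ω ∂μ ≤
        α / M := by
    intro x hx
    obtain ⟨h1, h2⟩ := measureReal_exceedCount_comp hS hinj hswap (Finset.mem_filter.1 hx).2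
    rw [integral_finsetSum _ fun k _ => hint x k]
    simp only [integral_indicator_const _ (hA x _), smul_eq_mul]
    refine sum_rejection_prob_le
      ((measurable_exceedCount x.2).comp ((measurable_pi_apply x.1).comp hS))
      (fun ω => exceedCount_le _ _) h1 hRm (fun k r hr => ?_) (fun ω => rfl) (by positivity) M
    -- Larger p-values give a smaller count, so this set is increasing.
    refine h2 {p | fastLSUCount (fun j t => p ⟨j, t⟩) α ≤ k} (fun p p' hp h => ?_) r hr
    exact (fastLSUCount_antitone (fun j t => hp ⟨j, t⟩) hα).trans h
  refine (Finset.sum_le_card_nsmul _ _ _ hx).trans ?_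
  have hcard : (Finset.univ.filter fun x : (j : Fin K) × Fin (m j) => x.2 ∈ H0 x.1).card ≤ M :=
    (Finset.card_le_univ _).trans (by simp [M, totalTests])
  rw [nsmul_eq_mul]
  calc _ ≤ (M : ℝ) * (α / M) := by gcongr
    _ ≤ α := by
      -- With no tests at all, the bound is `0 * (α / 0) = 0`.
      rcases Nat.eq_zero_or_pos M with h0 | h0
      · simpa [h0] using hα
      · rw [mul_div_cancel₀]
        exact_mod_cast h0.ne'

end ScoreMeasure

end ModelExchange

theorem mainTheorem2 {Ω E : Type*} [MeasurableSpace Ω] [MeasurableSpace E]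
    (μ : Measure Ω) [IsProbabilityMeasure μ]
    -- the number of agents; sizes of each of the `K` blocks of agent `a`
    (K : ℕ) (hK : 2 ≤ K) (k ℓ m : Fin K → ℕ)
    -- `Z a b` is the block that agent `a` designates for agent `b`; `Z j j` is agent `j`'s own
    -- evaluation block
    (Z : (a b : Fin K) → ModelExchange.BlockIdx (k a) (ℓ a) (m a) → Ω → E)
    (hZ : ∀ a b x, Measurable (Z a b x))
    -- local null distributions
    (P0 : Fin K → Measure E) (hP0 : ∀ a, IsProbabilityMeasure (P0 a))
    (htrain : ∀ a b (i : Fin (k a)), μ.map (Z a b (ModelExchange.trainIdx i)) = P0 a)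
    (hcal : ∀ a b (i : Fin (ℓ a)), μ.map (Z a b (ModelExchange.calIdx i)) = P0 a)
    -- true nulls among the evaluated test samples: a sample with law `P0 j` is null, and a sample
    -- whose law differs from every `P0 a` is not
    (H0 : (j : Fin K) → Set (Fin (m j)))
    (hnull : ∀ j (t : Fin (m j)), μ.map (Z j j (ModelExchange.testIdx t)) = P0 j → t ∈ H0 j)
    (hnovel : ∀ j (t : Fin (m j)),
      (∀ a, μ.map (Z j j (ModelExchange.testIdx t)) ≠ P0 a) → t ∉ H0 j)
    -- the data of different agents are independent, and so are the blocks of each agent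
    (hagents : iIndepFun (fun (a : Fin K) (ω : Ω) =>
      (fun b x => Z a b x ω : Fin K → ModelExchange.BlockIdx (k a) (ℓ a) (m a) → E)) μ)
    (hblocks : ∀ a, iIndepFun (fun (b : Fin K) (ω : Ω) =>
      (fun x => Z a b x ω : ModelExchange.BlockIdx (k a) (ℓ a) (m a) → E)) μ)
    -- nulls are exchangeable conditionally on the novelties
    (hexch : ∀ j, ModelExchange.CondExchangeable μ
      (fun x : {x // x ∈ ModelExchange.nullPositions (k := k j) (ℓ := ℓ j) (H0 j)} => Z j j x.1)
      (fun t : {t // t ∉ H0 j} => Z j j (ModelExchange.testIdx t.1)))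
    -- score functions learned from a block, not depending on the order of the block's calibration
    -- and test samples
    (g : (a : Fin K) → E → (ModelExchange.BlockIdx (k a) (ℓ a) (m a) → E) → ℝ)
    (hg : ∀ a, Measurable (Function.uncurry (g a)))
    (hginv : ∀ a z (h : ModelExchange.BlockIdx (k a) (ℓ a) (m a) → E)
      (π : Equiv.Perm (Fin (ℓ a) ⊕ Fin (m a))), g a z (h ∘ Sum.map id π) = g a z h)
    -- almost surely no ties among the composite calibration and test scores of an agent
    (hties : ∀ j, ∀ᵐ ω ∂μ, Function.Injective fun x : Fin (ℓ j) ⊕ Fin (m j) =>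
      ModelExchange.compositeScore g j (fun a y => Z a j y ω) (Z j j (Sum.inr x) ω))
    (α : ℝ) (hα0 : 0 < α) (hα1 : α < 1) :
    ModelExchange.IsPRDS μ
        (fun (s : (j : Fin K) × Fin (m j)) ω =>
          ModelExchange.pValue g s.1 (fun a y => Z a s.1 y ω) s.2)
        {s | s.2 ∈ H0 s.1} ∧
      Integrable (fun ω => ModelExchange.globalFDP H0 (ModelExchange.fastLSURejections
        (fun j => ModelExchange.pValue g j (fun a y => Z a j y ω)) α)) μ ∧
      ∫ ω, ModelExchange.globalFDP H0 (ModelExchange.fastLSURejections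
        (fun j => ModelExchange.pValue g j (fun a y => Z a j y ω)) α) ∂μ ≤ α := by
  have hblock : ∀ a b, Measurable fun ω x => Z a b x ω :=
    fun a b => measurable_pi_lambda _ (hZ a b)
  have hdata : Measurable fun ω a b x => Z a b x ω :=
    measurable_pi_lambda _ fun a => measurable_pi_lambda _ (hblock a)
  have hscore := ModelExchange.measurable_scoreFamily hg
  have hS : Measurable fun ω => ModelExchange.scoreFamily g fun a b x => Z a b x ω :=
    hscore.comp hdata
  have hswap : ∀ j, ∀ t ∈ H0 j, ∀ c, MeasurePreserving (ModelExchange.swapScores j t c)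
      (μ.map fun ω => ModelExchange.scoreFamily g fun a b x => Z a b x ω)
      (μ.map fun ω => ModelExchange.scoreFamily g fun a b x => Z a b x ω) := by
    intro j t ht c
    have hD := ModelExchange.measurePreserving_swapData hZ hagents hblocks
      (ModelExchange.map_block_swap (hZ j j) (hexch j) ht c)
    have hlaw : (μ.map fun ω => ModelExchange.scoreFamily g fun a b x => Z a b x ω) =
        (μ.map fun ω a b x => Z a b x ω).map (ModelExchange.scoreFamily g) :=
      (Measure.map_map hscore hdata).symm
    have hm := ModelExchange.measurable_swapScores (ℓ := ℓ) (m := m) j t c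
    refine ⟨hm, ?_⟩
    -- Equivariance of the score map carries the invariance of the data law over to the law of the
    -- scores.
    have hcomm : ModelExchange.swapScores j t c ∘ ModelExchange.scoreFamily g =
        ModelExchange.scoreFamily g ∘ ModelExchange.swapData j t c :=
      funext fun d => (ModelExchange.scoreFamily_swapData hginv j t c d).symm
    rw [hlaw, Measure.map_map hm hscore, hcomm, ← Measure.map_map hscore hD.measurable, hD.map_eq]
  have hp : ∀ ω, (fun j => ModelExchange.pValue g j fun a y => Z a j y ω) = fun j t =>
      ModelExchange.pValueFamily (ModelExchange.scoreFamily g fun a b x => Z a b x ω) ⟨j, t⟩ :=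
    fun ω => funext fun j => funext fun t =>
      ModelExchange.pValue_eq_pValueFamily g (fun a b x => Z a b x ω) ⟨j, t⟩
  have hp' : (fun (s : (j : Fin K) × Fin (m j)) ω =>
      ModelExchange.pValue g s.1 (fun a y => Z a s.1 y ω) s.2) = fun s ω =>
      ModelExchange.pValueFamily (ModelExchange.scoreFamily g fun a b x => Z a b x ω) s :=
    funext fun s => funext fun ω =>
      ModelExchange.pValue_eq_pValueFamily g (fun a b x => Z a b x ω) s
  simp only [hp, hp']
  exact ⟨ModelExchange.isPRDS_pValueFamily hS hties hswap,
    ModelExchange.globalFDP_pValueFamily_le hS hties hswap hα0.le⟩
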